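/- Let $n\ge 1$, $X\in\mathbb R^{n\times p}$, $\beta^0\in\mathbb R^p$, $Y=X\beta^0+\epsilon$ with i.i.d. Gaussian errors $\epsilon_i\sim\mathcal N(0,\sigma^2)$, $\sigma>0$. Write $\|a\|_n^2=\sum_{i=1}^n a_i^2/n$ for $a\in\mathbb R^n$. Let $\Omega$ be a norm on $\mathbb R^p$. For $S\subseteq\{1,\dots,p\}$ let $\beta_S$ be the part of $\beta$ on $S$ (extended by $0$ where a vector of $\mathbb R^p$ is needed). Call $S$ allowed if $\Omega$ is weakly decomposable for $S$, i.e. if there is a norm $\Omega^{S^c}$ on $\mathbb R^{|S^c|}$ with $\Omega(\beta)\ge\Omega(\beta_S)+\Omega^{S^c}(\beta_{S^c})$ for all $\beta$; fix such a norm $\Omega^{S^c}$ for each allowed $S$. A star on a norm denotes the dual norm, $N^*(x)=\max_{N(z)\le 1}z^Tx$. Let $0\le\delta<1$ and $0<\alpha<1$, $t=\sqrt{\log(4/\alpha)}$, and let $\Delta>0$ satisfy $\Delta^2=1-t\sqrt{2/n}$ or $\Delta^2=1-2t/\sqrt n$. Let $D$ be a constant with $\|\beta\|_2\le D\,\Omega(\beta)$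 for all $\beta$, let $W$ be an allowed set, $$V=\frac{1}{n\sigma}\max\left(\Omega^*((\epsilon^TX)_W),\ \Omega^{W^c*}((\epsilon^TX)_{W^c})\right),\qquad \lambda=\frac t\Delta\, D\sqrt{\frac2n}+\mathrm E[V].$$ Let $\hat\beta$ be any minimizer of $\|Y-X\beta\|_n+\lambda\Omega(\beta)$ over $\beta\in\mathbb R^p$. Put $$f=\frac{\lambda\Omega(\beta^0)}{\|\epsilon\|_n},\quad \lambda^0=\frac{\Omega^*(\epsilon^TX)}{n\|\epsilon\|_n},\quad \lambda^m=\lambda^m(S)=\frac{\max\left(\Omega^*((\epsilon^TX)_S),\ \Omega^{S^c*}((\epsilon^TX)_{S^c})\right)}{n\|\epsilon\|_n},$$ $$\tilde\lambda=\lambda(1+f),\quad \lambda^*=\lambda\,\frac{1-\frac{\lambda^0}{\lambda}(1+2f)}{f+2},\quad L_S=\frac{\tilde\lambda+\lambda^m}{\lambda^*-\lambda^m}\cdot\frac{1+\delta}{1-\delta},$$ $$\delta_\Omega(L,S)=\min\{\|X\beta_S-X\beta_{S^c}\|_n:\ \Omega(\beta_S)=1,\ \Omega^{S^c}(\beta_{S^c})\le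 L\},\qquad \Gamma_\Omega^2(L,S)=\delta_\Omega(L,S)^{-2}\in[0,\infty]$$ (with $\min\emptyset=\infty$, $1/0=\infty$, $1/\infty=0$). Let $(S_\star,\beta_\star)$ be any minimizer of $$\|X(\beta-\beta^0)\|_n^2+\|\epsilon\|_n^2\left[(1+\delta)(\tilde\lambda+\lambda^m)\right]^2\Gamma_\Omega^2(L_S,S)$$ over all allowed sets $S$ with $3(1+f)\lambda^m(S)<\lambda$ and all $\beta$ with $\operatorname{supp}\beta\subseteq S$. Write $\lambda^m(S_\star)=C\lambda$ (so that $0\le C<\frac1{3(1+f)}$) and $$C_1=(1+\delta)^2\|\epsilon\|_n^2(f+C+1)^2,\qquad C_2=\frac1{2\delta\|\epsilon\|_n}\cdot\frac{1}{\frac{1-C(1+2f)}{f+2}-C}.$$ Then there is an event of probability at least $1-\alpha$ at every point of which, for all such $\hat\beta$ and all such $(S_\star,\beta_\star)$ (if some allowed $S$ satisfies $3(1+f)\lambda^m(S)<\lambda$ at that point), $$\|X(\hat\beta-\beta^0)\|_n^2\le\|X(\beta_\star-\beta^0)\|_n^2+C_1\lambda^2\,\Gamma_\Omega^2(L_{S_\star},S_\star),$$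 and, if $\delta>0$, $$\Omega(\hat\beta_{S_\star}-\beta_\star)+\Omega^{S_\star^c}(\hat\beta_{S_\star^c})\le C_2\left(\frac{\|X(\beta_\star-\beta^0)\|_n^2}{\lambda}+C_1\lambda\,\Gamma_\Omega^2(L_{S_\star},S_\star)\right).$$ -/

import Mathlib

open MeasureTheory ProbabilityTheory
open scoped NNReal ENNReal Matrix

namespace SqrtReg

noncomputable section

/-- The normalized Euclidean norm `‖a‖ₙ = √(∑ aᵢ² / n)` on `ℝⁿ`. -/
def normN {n : ℕ} (a : Fin n → ℝ) : ℝ := √((∑ i, a i ^ 2) / n)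

/-- A norm on a real vector space: a seminorm that vanishes only at `0`. -/
def IsNorm {E : Type*} [AddCommGroup E] [Module ℝ E] (N : Seminorm ℝ E) : Prop :=
  ∀ x, N x = 0 → x = 0

/-- The vector `β_S`, regarded as an element of `ℝᵖ` (zero outside `S`). -/
def restr {p : ℕ} (S : Finset (Fin p)) (β : Fin p → ℝ) : Fin p → ℝ :=
  fun j => if j ∈ S then β j else 0

/-- The vector `β_{Sᶜ}`, regarded as an element of `ℝ^{|Sᶜ|}`. -/
def offPart {p : ℕ} (S : Finset (Fin p)) (β : Fin p → ℝ) : {j : Fin p // j ∉ S} → ℝ :=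
  fun j => β j

/-- The dual norm `N*(x) = max {zᵀx : N(z) ≤ 1}`. -/
def dualNorm {ι : Type*} [Fintype ι] (N : Seminorm ℝ (ι → ℝ)) (x : ι → ℝ) : ℝ :=
  sSup {r : ℝ | ∃ z : ι → ℝ, N z ≤ 1 ∧ r = z ⬝ᵥ x}

/-- `Ω(β) ≥ Ω(β_S) + N(β_{Sᶜ})` for all `β`. -/
def WeaklyDecomposes {p : ℕ} (Ω : Seminorm ℝ (Fin p → ℝ)) (S : Finset (Fin p))
    (N : Seminorm ℝ ({j : Fin p // j ∉ S} → ℝ)) : Prop :=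
  ∀ β, Ω (restr S β) + N (offPart S β) ≤ Ω β

/-- `S` is allowed for `Ω`: the norm `Ω` is weakly decomposable for `S`. -/
def Allowed {p : ℕ} (Ω : Seminorm ℝ (Fin p → ℝ)) (S : Finset (Fin p)) : Prop :=
  ∃ N : Seminorm ℝ ({j : Fin p // j ∉ S} → ℝ), IsNorm N ∧ WeaklyDecomposes Ω S N

/-- The square root regularization estimators: minimizers of `‖Y - Xβ‖ₙ + λ Ω(β)`. -/
def IsEstimator {n p : ℕ} (X : Matrix (Fin n) (Fin p) ℝ) (Y : Fin n → ℝ)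
    (Ω : Seminorm ℝ (Fin p → ℝ)) (lam : ℝ) (b : Fin p → ℝ) : Prop :=
  ∀ β : Fin p → ℝ, normN (Y - X *ᵥ b) + lam * Ω b ≤ normN (Y - X *ᵥ β) + lam * Ω β

/-- The `Ω`-eigenvalue `δ_Ω(L, S)`, where `N` is the norm `Ω^{Sᶜ}`. It is `∞` if no vector
satisfies the two constraints (for instance if `S = ∅`). -/
def eigenvalue {n p : ℕ} (X : Matrix (Fin n) (Fin p) ℝ) (Ω : Seminorm ℝ (Fin p → ℝ))
    (S : Finset (Fin p)) (N : Seminorm ℝ ({j : Fin p // j ∉ S} → ℝ)) (L : ℝ) : ℝ≥0∞ :=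
  ⨅ β ∈ {β : Fin p → ℝ | Ω (restr S β) = 1 ∧ N (offPart S β) ≤ L},
    ENNReal.ofReal (normN (X *ᵥ restr S β - X *ᵥ restr Sᶜ β))

/-- The squared effective sparsity `Γ_Ω²(L, S) = 1 / δ_Ω²(L, S)`, with `1/0 = ∞`, `1/∞ = 0`. -/
def effSparsitySq {n p : ℕ} (X : Matrix (Fin n) (Fin p) ℝ) (Ω : Seminorm ℝ (Fin p → ℝ))
    (S : Finset (Fin p)) (N : Seminorm ℝ ({j : Fin p // j ∉ S} → ℝ)) (L : ℝ) : ℝ≥0∞ :=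
  (eigenvalue X Ω S N L ^ 2)⁻¹

/-- `f = λ Ω(β⁰) / ‖ε‖ₙ`. Below, `e` always stands for a realization of the noise vector. -/
def fVal {n p : ℕ} (Ω : Seminorm ℝ (Fin p → ℝ)) (lam : ℝ) (β0 : Fin p → ℝ)
    (e : Fin n → ℝ) : ℝ :=
  lam * Ω β0 / normN e

/-- `max (Ω*((εᵀX)_S), Ω^{Sᶜ}*((εᵀX)_{Sᶜ}))`, where `N` is the norm `Ω^{Sᶜ}`. -/
def maxDual {n p : ℕ} (X : Matrix (Fin n) (Fin p) ℝ) (Ω : Seminorm ℝ (Fin p → ℝ))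
    (S : Finset (Fin p)) (N : Seminorm ℝ ({j : Fin p // j ∉ S} → ℝ)) (e : Fin n → ℝ) : ℝ :=
  max (dualNorm Ω (restr S (e ᵥ* X))) (dualNorm N (offPart S (e ᵥ* X)))

/-- `λᵐ = max (λ^S, λ^{Sᶜ})`. -/
def lamM {n p : ℕ} (X : Matrix (Fin n) (Fin p) ℝ) (Ω : Seminorm ℝ (Fin p → ℝ))
    (S : Finset (Fin p)) (N : Seminorm ℝ ({j : Fin p // j ∉ S} → ℝ)) (e : Fin n → ℝ) : ℝ :=
  maxDual X Ω S N e / (n * normN e)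

/-- `λ⁰ = Ω*(εᵀX) / (n ‖ε‖ₙ)`. -/
def lam0 {n p : ℕ} (X : Matrix (Fin n) (Fin p) ℝ) (Ω : Seminorm ℝ (Fin p → ℝ))
    (e : Fin n → ℝ) : ℝ :=
  dualNorm Ω (e ᵥ* X) / (n * normN e)

/-- `λ* = λ (1 - (λ⁰/λ)(1 + 2f)) / (f + 2)`. -/
def lamStar {n p : ℕ} (X : Matrix (Fin n) (Fin p) ℝ) (Ω : Seminorm ℝ (Fin p → ℝ))
    (lam : ℝ) (β0 : Fin p → ℝ) (e : Fin n → ℝ) : ℝ :=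
  lam * ((1 - lam0 X Ω e / lam * (1 + 2 * fVal Ω lam β0 e)) / (fVal Ω lam β0 e + 2))

/-- `λ̃ = λ (1 + f)`. -/
def lamTilde {n p : ℕ} (Ω : Seminorm ℝ (Fin p → ℝ)) (lam : ℝ) (β0 : Fin p → ℝ)
    (e : Fin n → ℝ) : ℝ :=
  lam * (1 + fVal Ω lam β0 e)

/-- `L_S = (λ̃ + λᵐ)/(λ* - λᵐ) · (1 + δ)/(1 - δ)`. -/
def coneConst {n p : ℕ} (X : Matrix (Fin n) (Fin p) ℝ) (Ω : Seminorm ℝ (Fin p → ℝ))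
    (S : Finset (Fin p)) (N : Seminorm ℝ ({j : Fin p // j ∉ S} → ℝ))
    (lam δ : ℝ) (β0 : Fin p → ℝ) (e : Fin n → ℝ) : ℝ :=
  (lamTilde Ω lam β0 e + lamM X Ω S N e) / (lamStar X Ω lam β0 e - lamM X Ω S N e)
    * ((1 + δ) / (1 - δ))

/-- `Γ_Ω²(L_S, S)`. -/
def gammaSq {n p : ℕ} (X : Matrix (Fin n) (Fin p) ℝ) (Ω : Seminorm ℝ (Fin p → ℝ))
    (S : Finset (Fin p)) (N : Seminorm ℝ ({j : Fin p // j ∉ S} → ℝ))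
    (lam δ : ℝ) (β0 : Fin p → ℝ) (e : Fin n → ℝ) : ℝ≥0∞ :=
  effSparsitySq X Ω S N (coneConst X Ω S N lam δ β0 e)

/-- `‖X(β - β⁰)‖ₙ² + ‖ε‖ₙ² [(1 + δ)(λ̃ + λᵐ)]² Γ_Ω²(L_S, S)`. -/
def oracleBound {n p : ℕ} (X : Matrix (Fin n) (Fin p) ℝ) (Ω : Seminorm ℝ (Fin p → ℝ))
    (S : Finset (Fin p)) (N : Seminorm ℝ ({j : Fin p // j ∉ S} → ℝ))
    (lam δ : ℝ) (β0 : Fin p → ℝ) (e : Fin n → ℝ) (β : Fin p → ℝ) : ℝ≥0∞ :=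
  ENNReal.ofReal (normN (X *ᵥ (β - β0)) ^ 2)
    + ENNReal.ofReal (normN e ^ 2 * ((1 + δ) * (lamTilde Ω lam β0 e + lamM X Ω S N e)) ^ 2)
      * gammaSq X Ω S N lam δ β0 e

/-- The sets to which the oracle inequality applies: `S` is allowed and `3(1 + f) λᵐ < λ`. -/
def Admissible {n p : ℕ} (X : Matrix (Fin n) (Fin p) ℝ) (Ω : Seminorm ℝ (Fin p → ℝ))
    (ΩC : (S : Finset (Fin p)) → Seminorm ℝ ({j : Fin p // j ∉ S} → ℝ))
    (lam : ℝ) (β0 : Fin p → ℝ) (e : Fin n → ℝ) (S : Finset (Fin p)) : Prop :=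
  Allowed Ω S ∧ 3 * (1 + fVal Ω lam β0 e) * lamM X Ω S (ΩC S) e < lam

/-- `(S⋆, β⋆)` minimizes the oracle bound among all admissible `S` and `β` with `supp β ⊆ S`. -/
def IsOracle {n p : ℕ} (X : Matrix (Fin n) (Fin p) ℝ) (Ω : Seminorm ℝ (Fin p → ℝ))
    (ΩC : (S : Finset (Fin p)) → Seminorm ℝ ({j : Fin p // j ∉ S} → ℝ))
    (lam δ : ℝ) (β0 : Fin p → ℝ) (e : Fin n → ℝ)
    (S : Finset (Fin p)) (β : Fin p → ℝ) : Prop :=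
  Admissible X Ω ΩC lam β0 e S ∧ (∀ j, j ∉ S → β j = 0) ∧
    ∀ (S' : Finset (Fin p)) (β' : Fin p → ℝ),
      Admissible X Ω ΩC lam β0 e S' → (∀ j, j ∉ S' → β' j = 0) →
        oracleBound X Ω S (ΩC S) lam δ β0 e β ≤ oracleBound X Ω S' (ΩC S') lam δ β0 e β'

/-- `C₁ = (1 + δ)² ‖ε‖ₙ² (f + C + 1)²`. -/
def constC1 {n : ℕ} (δ : ℝ) (e : Fin n → ℝ) (f C : ℝ) : ℝ :=
  (1 + δ) ^ 2 * normN e ^ 2 * (f + C + 1) ^ 2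

/-- `C₂ = 1/(2δ‖ε‖ₙ) · 1/((1 - C(1 + 2f))/(f + 2) - C)`. -/
def constC2 {n : ℕ} (δ : ℝ) (e : Fin n → ℝ) (f C : ℝ) : ℝ :=
  1 / (2 * δ * normN e) * (1 / ((1 - C * (1 + 2 * f)) / (f + 2) - C))

end

end SqrtReg

/-! The bounds are deterministic. At every noise vector e ≠ 0, hence almost surely, they hold for
each admissible S and each β supported on S, in particular at the oracle; the condition 3(1+f)λᵐ < λ
by itself supplies the control of the noise.

Let b be the estimator and r its residual. The square root loss acts like least squares with penalty
level λ‖r‖ₙ: optimality gives rᵀX(β - b) ≤ nλ‖r‖ₙ(Ω(β) - Ω(b))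
(`IsEstimator.residual_dotProduct_le`). This random level is sandwiched, λ*‖e‖ₙ ≤ λ‖r‖ₙ ≤ λ̃‖e‖ₙ;
the lower half is `IsEstimator.lamStar_mul_normN_le`.

Put u = Ω(b_S - β) and v = Ω^{Sᶜ}(b_{Sᶜ}). Weak decomposability gives Ω(β) - Ω(b) ≤ u - v, and
duality bounds the noise term by a multiple λᵐ of u + v. Polarization then yields ‖X(b-β⁰)‖ₙ² +
‖X(b-β)‖ₙ² ≤ ‖X(β-β⁰)‖ₙ² + 2‖e‖ₙ((λ̃+λᵐ)u - (λ*-λᵐ)v). Either v is so large that the last term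
absorbs the estimation error, or v ≤ L_S u and the Ω-eigenvalue bounds u by ‖X(b-β)‖ₙ, whose square
on the left pays for the term in u (`IsEstimator.sharp_oracle`). -/

namespace SqrtReg

/-! ### Norms on `ℝᵐ` and their duals -/

/-- Convexity makes N continuous in finite dimension, so it attains a positive minimum on the
compact unit sphere; homogeneity does the rest. The sphere is empty only when the space is trivial.
-/
lemma IsNorm.exists_pos_mul_norm_le {ι : Type*} [Fintype ι] {N : Seminorm ℝ (ι → ℝ)}
    (hN : IsNorm N) : ∃ c : ℝ, 0 < c ∧ ∀ z, c * ‖z‖ ≤ N z := by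
  have hcont : Continuous N :=
    continuousOn_univ.1 (N.convexOn.continuousOn isOpen_univ)
  rcases (Metric.sphere (0 : ι → ℝ) 1).eq_empty_or_nonempty with h | h
  · refine ⟨1, one_pos, fun z => ?_⟩
    have hz : z = 0 := by
      by_contra hz
      have : ‖z‖⁻¹ • z ∈ Metric.sphere (0 : ι → ℝ) 1 := by
        simp [norm_smul, norm_ne_zero_iff.2 hz]
      simp [h] at this
    simp [hz]
  · obtain ⟨x, hx, hmin⟩ := (isCompact_sphere (0 : ι → ℝ) 1).exists_isMinOn h hcont.continuousOn
    have hx0 : x ≠ 0 := by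
      rintro rfl
      simp at hx
    refine ⟨N x, (apply_nonneg N x).lt_of_ne fun h0 => hx0 (hN x h0.symm), fun z => ?_⟩
    by_cases hz : z = 0
    · simp [hz]
    have hz' : 0 < ‖z‖ := norm_pos_iff.2 hz
    have hmem : ‖z‖⁻¹ • z ∈ Metric.sphere (0 : ι → ℝ) 1 := by
      simp [norm_smul, hz'.ne']
    have hle : N x ≤ N (‖z‖⁻¹ • z) := hmin hmem
    rw [map_smul_eq_mul, norm_inv, norm_norm, inv_mul_eq_div, le_div_iff₀ hz'] at hle
    exact hle

/-- Guards against the default value 0 that `sSup` takes on unbounded sets. -/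
lemma IsNorm.bddAbove_dual {ι : Type*} [Fintype ι] {N : Seminorm ℝ (ι → ℝ)}
    (hN : IsNorm N) (x : ι → ℝ) :
    BddAbove {r : ℝ | ∃ z : ι → ℝ, N z ≤ 1 ∧ r = z ⬝ᵥ x} := by
  obtain ⟨c, hc, hle⟩ := hN.exists_pos_mul_norm_le
  refine ⟨c⁻¹ * ∑ i, |x i|, ?_⟩
  rintro _ ⟨z, hz, rfl⟩
  have hzc : ‖z‖ ≤ c⁻¹ := by
    rw [← one_div, le_div_iff₀ hc, mul_comm]
    exact (hle z).trans hz
  rw [Finset.mul_sum]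
  refine Finset.sum_le_sum fun i _ => (le_abs_self _).trans ?_
  rw [abs_mul]
  exact mul_le_mul_of_nonneg_right ((norm_le_pi_norm z i).trans hzc) (abs_nonneg _)

lemma dualNorm_nonneg {ι : Type*} [Fintype ι] (N : Seminorm ℝ (ι → ℝ)) (x : ι → ℝ) :
    0 ≤ dualNorm N x :=
  Real.sSup_nonneg' ⟨0, ⟨0, by simp⟩, le_rfl⟩

lemma IsNorm.dotProduct_le {ι : Type*} [Fintype ι] {N : Seminorm ℝ (ι → ℝ)}
    (hN : IsNorm N) (z x : ι → ℝ) : z ⬝ᵥ x ≤ N z * dualNorm N x := by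
  by_cases hz : N z = 0
  · simp [hN z hz]
  have hz' : 0 < N z := (apply_nonneg N z).lt_of_ne' hz
  have hle : ((N z)⁻¹ • z) ⬝ᵥ x ≤ dualNorm N x :=
    le_csSup (hN.bddAbove_dual x) ⟨_, by simp [map_smul_eq_mul, abs_of_pos hz', hz], rfl⟩
  rwa [smul_dotProduct, smul_eq_mul, inv_mul_eq_div, div_le_iff₀ hz', mul_comm] at hle

lemma maxDual_nonneg {n p : ℕ} (X : Matrix (Fin n) (Fin p) ℝ) (Ω : Seminorm ℝ (Fin p → ℝ))
    (S : Finset (Fin p)) (N : Seminorm ℝ ({j : Fin p // j ∉ S} → ℝ)) (e : Fin n → ℝ) :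
    0 ≤ maxDual X Ω S N e :=
  le_max_of_le_left (dualNorm_nonneg _ _)

/-! ### Splitting a vector into its parts on and off `S` -/

lemma dotProduct_eq_restr_add_offPart {p : ℕ} (S : Finset (Fin p)) (z x : Fin p → ℝ) :
    z ⬝ᵥ x = restr S z ⬝ᵥ restr S x + offPart S z ⬝ᵥ offPart S x := by
  simp only [dotProduct, restr, offPart]
  rw [← Finset.sum_subtype Sᶜ (by simp) fun j => z j * x j, ← Finset.sum_add_sum_compl S]
  congr 1
  simp [Finset.sum_ite_mem]

lemma dotProduct_le_maxDual {n p : ℕ} (X : Matrix (Fin n) (Fin p) ℝ)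
    {Ω : Seminorm ℝ (Fin p → ℝ)} (hΩ : IsNorm Ω) {S : Finset (Fin p)}
    {N : Seminorm ℝ ({j : Fin p // j ∉ S} → ℝ)} (hN : IsNorm N) (e : Fin n → ℝ)
    (z : Fin p → ℝ) :
    z ⬝ᵥ (e ᵥ* X) ≤ maxDual X Ω S N e * (Ω (restr S z) + N (offPart S z)) := by
  rw [dotProduct_eq_restr_add_offPart S, mul_add, mul_comm _ (Ω _), mul_comm _ (N _)]
  exact add_le_add
    ((hΩ.dotProduct_le _ _).trans
      (mul_le_mul_of_nonneg_left (le_max_left _ _) (apply_nonneg _ _)))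
    ((hN.dotProduct_le _ _).trans
      (mul_le_mul_of_nonneg_left (le_max_right _ _) (apply_nonneg _ _)))

/-- Weak decomposability puts the unit ball of Ω inside that of Ω(β_S) + N(β_{Sᶜ}), and duality
reverses the inclusion. This is the source of λ⁰ ≤ λᵐ. -/
lemma dualNorm_le_maxDual {n p : ℕ} (X : Matrix (Fin n) (Fin p) ℝ)
    {Ω : Seminorm ℝ (Fin p → ℝ)} (hΩ : IsNorm Ω) {S : Finset (Fin p)}
    {N : Seminorm ℝ ({j : Fin p // j ∉ S} → ℝ)} (hN : IsNorm N)
    (hS : WeaklyDecomposes Ω S N) (e : Fin n → ℝ) :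
    dualNorm Ω (e ᵥ* X) ≤ maxDual X Ω S N e := by
  refine csSup_le ⟨0, 0, by simp⟩ ?_
  rintro _ ⟨z, hz, rfl⟩
  exact (dotProduct_le_maxDual X hΩ hN e z).trans
    (mul_le_of_le_one_right (maxDual_nonneg X Ω S N e) ((hS z).trans hz))

/-! ### The normalized Euclidean norm -/

lemma normN_nonneg {n : ℕ} (a : Fin n → ℝ) : 0 ≤ normN a := Real.sqrt_nonneg _

lemma dotProduct_self_eq {n : ℕ} (hn : 0 < n) (a : Fin n → ℝ) :
    a ⬝ᵥ a = n * normN a ^ 2 := by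
  have hn' : (n : ℝ) ≠ 0 := by exact_mod_cast hn.ne'
  rw [normN, Real.sq_sqrt (by positivity), mul_div_cancel₀ _ hn', dotProduct]
  exact Finset.sum_congr rfl fun i _ => (sq _).symm

lemma normN_pos {n : ℕ} (hn : 0 < n) {a : Fin n → ℝ} (ha : a ≠ 0) : 0 < normN a := by
  refine (normN_nonneg a).lt_of_ne' fun h => ha ?_
  have := dotProduct_self_eq hn a
  rw [h] at this
  exact dotProduct_self_eq_zero.1 (by simpa using this)

lemma normN_smul {n : ℕ} (c : ℝ) (a : Fin n → ℝ) : normN (c • a) = |c| * normN a := by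
  simp only [normN, Pi.smul_apply, smul_eq_mul, mul_pow]
  rw [← Finset.mul_sum, mul_div_assoc, Real.sqrt_mul (sq_nonneg c), Real.sqrt_sq_eq_abs]

lemma dotProduct_le_normN_mul {n : ℕ} (hn : 0 < n) (a c : Fin n → ℝ) :
    a ⬝ᵥ c ≤ n * (normN a * normN c) := by
  have hcs : (a ⬝ᵥ c) ^ 2 ≤ (n * (normN a * normN c)) ^ 2 := by
    have h := Finset.sum_mul_sq_le_sq_mul_sq Finset.univ a c
    have ha := dotProduct_self_eq hn a
    have hc := dotProduct_self_eq hn c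
    simp only [dotProduct, ← sq] at ha hc
    rw [ha, hc] at h
    calc (a ⬝ᵥ c) ^ 2 ≤ _ := h
      _ = _ := by ring
  exact abs_le_of_sq_le_sq' hcs
    (mul_nonneg n.cast_nonneg (mul_nonneg (normN_nonneg a) (normN_nonneg c))) |>.2

lemma normN_sub_sq {n : ℕ} (hn : 0 < n) (a c : Fin n → ℝ) :
    n * normN (a - c) ^ 2 = n * normN a ^ 2 - 2 * (a ⬝ᵥ c) + n * normN c ^ 2 := by
  rw [← dotProduct_self_eq hn, ← dotProduct_self_eq hn, ← dotProduct_self_eq hn]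
  simp only [sub_dotProduct, dotProduct_sub]
  rw [dotProduct_comm c a]
  ring

/-! ### Optimality of the estimator -/

/-- First order optimality: the residual of an estimator is a subgradient of the penalty. -/
lemma IsEstimator.residual_dotProduct_le {n p : ℕ} (hn : 0 < n)
    {X : Matrix (Fin n) (Fin p) ℝ} {Y : Fin n → ℝ} {Ω : Seminorm ℝ (Fin p → ℝ)} {lam : ℝ}
    (hlam : 0 ≤ lam) {b : Fin p → ℝ} (hb : IsEstimator X Y Ω lam b)
    (hres : 0 < normN (Y - X *ᵥ b)) (β : Fin p → ℝ) :
    (Y - X *ᵥ b) ⬝ᵥ (X *ᵥ (β - b)) ≤ n * (lam * normN (Y - X *ᵥ b) * (Ω β - Ω b)) := by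
  have hn' : (0 : ℝ) < n := by exact_mod_cast hn
  set r := Y - X *ᵥ b with hr
  set w := X *ᵥ (β - b) with hw
  -- Compare b with the point a fraction s of the way to β: the error is of order s², so it vanishes
  -- after division by s as s → 0.
  have key : ∀ s : ℝ, 0 < s → s ≤ 1 →
      r ⬝ᵥ w - n * (lam * normN r * (Ω β - Ω b)) ≤ s * (n * normN w ^ 2 / 2) := by
    intro s hs0 hs1
    have hopt := hb (b + s • (β - b))
    have hrs : Y - X *ᵥ (b + s • (β - b)) = r - s • w := by
      rw [Matrix.mulVec_add, Matrix.mulVec_smul, hr, hw, sub_sub]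
    have hconv : Ω (b + s • (β - b)) ≤ (1 - s) * Ω b + s * Ω β := by
      have : b + s • (β - b) = (1 - s) • b + s • β := by module
      rw [this]
      refine (map_add_le_add Ω _ _).trans (le_of_eq ?_)
      rw [map_smul_eq_mul, map_smul_eq_mul, Real.norm_of_nonneg (by linarith),
        Real.norm_of_nonneg hs0.le]
    rw [hrs] at hopt
    have hsq := normN_sub_sq hn r (s • w)
    rw [normN_smul, abs_of_pos hs0, dotProduct_smul, smul_eq_mul] at hsq
    have hlow : normN r - lam * (s * (Ω β - Ω b)) ≤ normN (r - s • w) := by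
      have := mul_le_mul_of_nonneg_left hconv hlam
      linarith
    -- The tangent bound y² ≥ 2xy - x² replaces differentiating the square root.
    have htan : normN r ^ 2 - 2 * normN r * (lam * (s * (Ω β - Ω b)))
        ≤ normN (r - s • w) ^ 2 := by
      nlinarith [sq_nonneg (normN (r - s • w) - normN r)]
    have hmul := mul_le_mul_of_nonneg_left htan hn'.le
    have : s * (r ⬝ᵥ w - n * (lam * normN r * (Ω β - Ω b)))
        ≤ s * (s * (n * normN w ^ 2 / 2)) := by linarith
    exact le_of_mul_le_mul_left this hs0
  by_contra hcon
  push Not at hcon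
  set g := r ⬝ᵥ w - n * (lam * normN r * (Ω β - Ω b)) with hg
  have hg0 : 0 < g := by linarith
  set K := n * normN w ^ 2 / 2 with hK
  have hK0 : 0 ≤ K := by positivity
  -- This s makes s * K ≤ g / 2, contradicting g ≤ s * K; K + 1 avoids dividing by zero.
  have h1 := key (min 1 (g / (2 * (K + 1)))) (by positivity) (min_le_left _ _)
  have h2 : min 1 (g / (2 * (K + 1))) * K ≤ g / (2 * (K + 1)) * K :=
    mul_le_mul_of_nonneg_right (min_le_right _ _) hK0
  have h3 : g / (2 * (K + 1)) * K ≤ g / 2 := by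
    rw [div_mul_eq_mul_div, div_le_div_iff₀ (by positivity) (by norm_num)]
    nlinarith
  linarith

lemma IsEstimator.normN_residual_le {n p : ℕ}
    {X : Matrix (Fin n) (Fin p) ℝ} {β0 : Fin p → ℝ} {e : Fin n → ℝ}
    {Ω : Seminorm ℝ (Fin p → ℝ)} {lam : ℝ} {b : Fin p → ℝ}
    (hb : IsEstimator X (X *ᵥ β0 + e) Ω lam b) :
    normN (X *ᵥ β0 + e - X *ᵥ b) + lam * Ω b ≤ normN e + lam * Ω β0 := by
  simpa using hb β0

/-- The residual of the estimator is bounded below: in particular it does not overfit. -/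
lemma IsEstimator.lamStar_mul_normN_le {n p : ℕ} (hn : 0 < n)
    {X : Matrix (Fin n) (Fin p) ℝ} {β0 : Fin p → ℝ} {e : Fin n → ℝ} (he : 0 < normN e)
    {Ω : Seminorm ℝ (Fin p → ℝ)} (hΩ : IsNorm Ω) {lam : ℝ} (hlam : 0 < lam)
    (hpos : 0 ≤ lamStar X Ω lam β0 e)
    {b : Fin p → ℝ} (hb : IsEstimator X (X *ᵥ β0 + e) Ω lam b) :
    lamStar X Ω lam β0 e * normN e ≤ lam * normN (X *ᵥ β0 + e - X *ᵥ b) := by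
  have hn' : (0 : ℝ) < n := by exact_mod_cast hn
  set r := X *ᵥ β0 + e - X *ᵥ b with hr
  set f := fVal Ω lam β0 e with hf
  set l := lam0 X Ω e with hl
  have hf0 : 0 ≤ f := by
    have := apply_nonneg Ω β0
    rw [hf, fVal]; positivity
  have hl0 : 0 ≤ l := div_nonneg (dualNorm_nonneg _ _) (by positivity)
  have hfe : lam * Ω β0 = f * normN e := by
    rw [hf, fVal, div_mul_cancel₀ _ he.ne']
  have hle : dualNorm Ω (e ᵥ* X) = l * (n * normN e) := by
    rw [hl, lam0, div_mul_cancel₀ _ (by positivity)]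
  have hup := hb.normN_residual_le
  rw [← hr] at hup
  have hΩd : lam * Ω (b - β0) ≤ (1 + 2 * f) * normN e - normN r := by
    have := mul_le_mul_of_nonneg_left (map_sub_le_add Ω b β0) hlam.le
    linarith
  have hcs := dotProduct_le_normN_mul hn e r
  have her : e ⬝ᵥ r = n * normN e ^ 2 - (b - β0) ⬝ᵥ (e ᵥ* X) := by
    have : r = e - X *ᵥ (b - β0) := by rw [hr, Matrix.mulVec_sub]; abel
    rw [this, dotProduct_sub, Matrix.dotProduct_mulVec, dotProduct_self_eq hn,
      dotProduct_comm (e ᵥ* X)]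
  have hdual := hΩ.dotProduct_le (b - β0) (e ᵥ* X)
  rw [hle] at hdual
  have h1 : normN e - l * Ω (b - β0) ≤ normN r := by
    have : (n * normN e) * (normN e - l * Ω (b - β0)) ≤ (n * normN e) * normN r := by
      linarith
    exact le_of_mul_le_mul_left this (by positivity)
  -- Insert the bound on Ω(b - β⁰) into `h1` and drop the nonnegative term l‖r‖ₙ.
  have h2 : (lam - l * (1 + 2 * f)) * normN e ≤ lam * normN r := by
    have := mul_le_mul_of_nonneg_left hΩd hl0
    have := mul_le_mul_of_nonneg_left h1 hlam.le
    have := mul_nonneg hl0 (normN_nonneg r)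
    linarith
  have hstar : lamStar X Ω lam β0 e * (f + 2) = lam - l * (1 + 2 * f) := by
    rw [lamStar, ← hf, ← hl]
    field_simp
  rw [← hstar] at h2
  -- The factor f + 2 ≥ 1 can be dropped because λ* ≥ 0.
  refine le_trans ?_ h2
  have := mul_nonneg (mul_nonneg hpos (by linarith : 0 ≤ f + 1)) he.le
  linarith

/-! ### The oracle inequality -/

lemma restr_add_restr_compl {p : ℕ} (S : Finset (Fin p)) (β : Fin p → ℝ) :
    restr S β + restr Sᶜ β = β := by
  ext j
  by_cases h : j ∈ S <;> simp [restr, h]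

lemma eigenvalue_le {n p : ℕ} (X : Matrix (Fin n) (Fin p) ℝ) (Ω : Seminorm ℝ (Fin p → ℝ))
    (S : Finset (Fin p)) (N : Seminorm ℝ ({j : Fin p // j ∉ S} → ℝ)) {L : ℝ}
    {b β : Fin p → ℝ} (hβ : ∀ j, j ∉ S → β j = 0) (hu : 0 < Ω (restr S b - β))
    (hL : N (offPart S b) ≤ L * Ω (restr S b - β)) :
    eigenvalue X Ω S N L
      ≤ ENNReal.ofReal (normN (X *ᵥ (b - β)) / Ω (restr S b - β)) := by
  set u := Ω (restr S b - β) with hu_def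
  -- The part off S is negated because the eigenvalue is defined with Xβ_S - Xβ_{Sᶜ}.
  set w : Fin p → ℝ := u⁻¹ • (restr S b - β - restr Sᶜ b) with hw
  have hS : restr S w = u⁻¹ • (restr S b - β) := by
    ext j
    by_cases h : j ∈ S <;> simp [hw, restr, h, hβ]
  have hSc : restr Sᶜ w = u⁻¹ • (-restr Sᶜ b) := by
    ext j
    by_cases h : j ∈ S <;> simp [hw, restr, h, hβ]
  have hoff : offPart S w = u⁻¹ • (-offPart S b) := by
    ext j
    simp [hw, restr, offPart, j.2, hβ]
  have hval : X *ᵥ restr S w - X *ᵥ restr Sᶜ w = u⁻¹ • (X *ᵥ (b - β)) := by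
    rw [← Matrix.mulVec_sub, hS, hSc, ← smul_sub, Matrix.mulVec_smul]
    congr 2
    nth_rewrite 3 [← restr_add_restr_compl S b]
    abel
  have hmem : Ω (restr S w) = 1 ∧ N (offPart S w) ≤ L := ⟨?_, ?_⟩
  · refine (iInf₂_le w hmem).trans (le_of_eq ?_)
    rw [hval, normN_smul, abs_inv, abs_of_pos hu, inv_mul_eq_div]
  · rw [hS, map_smul_eq_mul, norm_inv, Real.norm_of_nonneg hu.le, inv_mul_cancel₀ hu.ne']
  · rw [hoff, map_smul_eq_mul, map_neg_eq_map, norm_inv, Real.norm_of_nonneg hu.le,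
      inv_mul_eq_div, div_le_iff₀ hu]
    exact hL

/-- If `d u ≤ q` then `2 k u ≤ k² / d² + q²`. -/
lemma ofReal_two_mul_sub_sq_le {k u q : ℝ} (hk : 0 < k) (hu : 0 < u) (hq : 0 ≤ q) {d : ℝ≥0∞}
    (hd : d ≤ ENNReal.ofReal (q / u)) :
    ENNReal.ofReal (2 * k * u - q ^ 2) ≤ ENNReal.ofReal (k ^ 2) * (d ^ 2)⁻¹ := by
  -- For d = 0 the right side is ∞, since k ≠ 0.
  rcases eq_or_ne d 0 with rfl | hd0
  · have : ENNReal.ofReal (k ^ 2) ≠ 0 := by simpa using hk.ne'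
    simp [ENNReal.mul_top this]
  have hdt : d ≠ ⊤ := ne_top_of_le_ne_top ENNReal.ofReal_ne_top hd
  set c := d.toReal with hc
  have hc0 : 0 < c := ENNReal.toReal_pos hd0 hdt
  have hdc : d = ENNReal.ofReal c := (ENNReal.ofReal_toReal hdt).symm
  rw [hdc, ENNReal.ofReal_le_ofReal_iff (by positivity), le_div_iff₀ hu] at hd
  rw [hdc, ← ENNReal.ofReal_pow hc0.le, ← ENNReal.ofReal_inv_of_pos (by positivity),
    ← ENNReal.ofReal_mul (by positivity)]
  refine ENNReal.ofReal_le_ofReal ?_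
  have h1 : u ≤ q / c := by rw [le_div_iff₀ hc0]; linarith
  have h2 : 2 * k * u ≤ 2 * k * (q / c) := mul_le_mul_of_nonneg_left h1 (by linarith)
  have h3 : 2 * k * (q / c) = 2 * (k / c) * q := by ring
  have h4 : k ^ 2 * (c ^ 2)⁻¹ = (k / c) ^ 2 := by ring
  nlinarith [sq_nonneg (k / c - q)]

lemma lamM_nonneg {n p : ℕ} (X : Matrix (Fin n) (Fin p) ℝ) (Ω : Seminorm ℝ (Fin p → ℝ))
    (S : Finset (Fin p)) (N : Seminorm ℝ ({j : Fin p // j ∉ S} → ℝ)) (e : Fin n → ℝ) :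
    0 ≤ lamM X Ω S N e :=
  div_nonneg (maxDual_nonneg X Ω S N e) (mul_nonneg n.cast_nonneg (normN_nonneg e))

lemma fVal_nonneg {n p : ℕ} (Ω : Seminorm ℝ (Fin p → ℝ)) {lam : ℝ} (hlam : 0 ≤ lam)
    (β0 : Fin p → ℝ) (e : Fin n → ℝ) : 0 ≤ fVal Ω lam β0 e :=
  div_nonneg (mul_nonneg hlam (apply_nonneg Ω β0)) (normN_nonneg e)

/-- Replacing `λ⁰` by the larger `λᵐ` in `λ*` gives a lower bound of `λ*`. -/
lemma le_lamStar {n p : ℕ} (X : Matrix (Fin n) (Fin p) ℝ)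
    {Ω : Seminorm ℝ (Fin p → ℝ)} (hΩ : IsNorm Ω) {S : Finset (Fin p)}
    {N : Seminorm ℝ ({j : Fin p // j ∉ S} → ℝ)} (hN : IsNorm N)
    (hS : WeaklyDecomposes Ω S N) {lam : ℝ} (hlam : 0 < lam)
    (β0 : Fin p → ℝ) (e : Fin n → ℝ) :
    lam * ((1 - lamM X Ω S N e / lam * (1 + 2 * fVal Ω lam β0 e)) / (fVal Ω lam β0 e + 2))
      ≤ lamStar X Ω lam β0 e := by
  have hf := fVal_nonneg Ω hlam.le β0 e
  have h0 : lam0 X Ω e ≤ lamM X Ω S N e :=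
    div_le_div_of_nonneg_right (dualNorm_le_maxDual X hΩ hN hS e)
      (mul_nonneg n.cast_nonneg (normN_nonneg e))
  rw [lamStar]
  gcongr

/-- The sharp oracle inequality, for prediction and estimation error together. -/
theorem IsEstimator.sharp_oracle {n p : ℕ} (hn : 0 < n)
    {X : Matrix (Fin n) (Fin p) ℝ} {β0 : Fin p → ℝ} {e : Fin n → ℝ} (he : 0 < normN e)
    {Ω : Seminorm ℝ (Fin p → ℝ)} (hΩ : IsNorm Ω) {S : Finset (Fin p)}
    {N : Seminorm ℝ ({j : Fin p // j ∉ S} → ℝ)} (hN : IsNorm N)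
    (hS : WeaklyDecomposes Ω S N) {lam δ : ℝ} (hlam : 0 < lam) (hδ0 : 0 ≤ δ) (hδ1 : δ < 1)
    (hstar : lamM X Ω S N e < lamStar X Ω lam β0 e)
    {b : Fin p → ℝ} (hb : IsEstimator X (X *ᵥ β0 + e) Ω lam b)
    {β : Fin p → ℝ} (hβ : ∀ j, j ∉ S → β j = 0) :
    ENNReal.ofReal (normN (X *ᵥ (b - β0)) ^ 2 + 2 * δ * normN e
        * ((lamTilde Ω lam β0 e + lamM X Ω S N e) * Ω (restr S b - β)
          + (lamStar X Ω lam β0 e - lamM X Ω S N e) * N (offPart S b)))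
      ≤ oracleBound X Ω S N lam δ β0 e β := by
  have hn' : (0 : ℝ) < n := by exact_mod_cast hn
  have hf0 := fVal_nonneg Ω hlam.le β0 e
  have hm0 := lamM_nonneg X Ω S N e
  rw [oracleBound, gammaSq, coneConst]
  set f := fVal Ω lam β0 e with hf
  set m := lamM X Ω S N e with hm
  set A := lamTilde Ω lam β0 e + m with hA
  set B := lamStar X Ω lam β0 e - m with hB
  set u := Ω (restr S b - β) with hu
  set v := N (offPart S b) with hv
  set r := X *ᵥ β0 + e - X *ᵥ b with hr
  have hu0 : 0 ≤ u := apply_nonneg _ _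
  have hv0 : 0 ≤ v := apply_nonneg _ _
  have hA0 : 0 < A := by rw [hA, lamTilde, ← hf]; positivity
  have hB0 : 0 < B := sub_pos.2 hstar
  have hlow := hb.lamStar_mul_normN_le hn he hΩ hlam (by linarith)
  rw [← hr] at hlow
  have hr0 : 0 < normN r := by
    have : 0 < lam * normN r := lt_of_lt_of_le (mul_pos (by linarith) he) hlow
    exact pos_of_mul_pos_right this hlam.le
  have hup : lam * normN r ≤ lamTilde Ω lam β0 e * normN e := by
    have h1 := hb.normN_residual_le
    rw [← hr] at h1
    have h2 : lam * Ω β0 = f * normN e := by rw [hf, fVal, div_mul_cancel₀ _ he.ne']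
    have h3 := mul_nonneg hlam.le (apply_nonneg Ω b)
    have h4 : normN r ≤ (1 + f) * normN e := by linarith
    rw [lamTilde, ← hf, mul_assoc]
    exact mul_le_mul_of_nonneg_left h4 hlam.le
  have hopt := hb.residual_dotProduct_le hn hlam.le hr0 β
  rw [← hr] at hopt
  have hpen : Ω β - Ω b ≤ u - v := by
    have h1 := hS b
    have h2 : Ω β ≤ Ω (restr S b) + u := by
      have h := map_sub_le_add Ω (restr S b) (restr S b - β)
      rwa [sub_sub_cancel] at h
    linarith
  have hnoise : (b - β) ⬝ᵥ (e ᵥ* X) ≤ n * (normN e * m * (u + v)) := by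
    have h := dotProduct_le_maxDual X hΩ hN e (b - β)
    have h1 : restr S (b - β) = restr S b - β := by
      ext j
      by_cases hj : j ∈ S <;> simp [restr, hj, hβ]
    have h2 : offPart S (b - β) = offPart S b := by
      ext j
      simp [offPart, hβ j j.2]
    have h3 : maxDual X Ω S N e = m * (n * normN e) := by
      rw [hm, lamM, div_mul_cancel₀ _ (by positivity)]
    rw [h1, h2, h3] at h
    linarith
  have hcross : (X *ᵥ (b - β0)) ⬝ᵥ (X *ᵥ (b - β)) ≤ n * (normN e * (A * u - B * v)) := by
    have h1 : r = e - X *ᵥ (b - β0) := by rw [hr, Matrix.mulVec_sub]; abel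
    have h2 : X *ᵥ (β - b) = -(X *ᵥ (b - β)) := by
      rw [← Matrix.mulVec_neg, neg_sub]
    have h3 : r ⬝ᵥ (X *ᵥ (β - b))
        = (X *ᵥ (b - β0)) ⬝ᵥ (X *ᵥ (b - β)) - (b - β) ⬝ᵥ (e ᵥ* X) := by
      rw [h1, h2, dotProduct_neg, sub_dotProduct, Matrix.dotProduct_mulVec e,
        dotProduct_comm (e ᵥ* X)]
      ring
    rw [h3] at hopt
    -- The upper bound on λ‖r‖ₙ is used on u, the lower bound on v; hence λ̃ and λ* play different
    -- roles.
    have h4 : lam * normN r * (Ω β - Ω b)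
        ≤ normN e * (lamTilde Ω lam β0 e * u - lamStar X Ω lam β0 e * v) := by
      have h5 := mul_le_mul_of_nonneg_left hpen (by positivity : 0 ≤ lam * normN r)
      have h6 := mul_le_mul_of_nonneg_right hup hu0
      have h7 := mul_le_mul_of_nonneg_right hlow hv0
      linarith
    have h8 := mul_le_mul_of_nonneg_left h4 hn'.le
    have h9 : n * (normN e * (A * u - B * v))
        = n * (normN e * m * (u + v))
          + n * (normN e * (lamTilde Ω lam β0 e * u - lamStar X Ω lam β0 e * v)) := by
      rw [hA, hB]; ring
    linarith
  set P := normN (X *ᵥ (b - β0)) with hP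
  set Q := normN (X *ᵥ (β - β0)) with hQ
  set q := normN (X *ᵥ (b - β)) with hq
  have hpol : P ^ 2 + q ^ 2 ≤ Q ^ 2 + 2 * (normN e * (A * u - B * v)) := by
    have h1 := normN_sub_sq hn (X *ᵥ (b - β0)) (X *ᵥ (b - β))
    rw [← Matrix.mulVec_sub, sub_sub_sub_cancel_left, ← hP, ← hQ, ← hq] at h1
    have : n * (P ^ 2 + q ^ 2) ≤ n * (Q ^ 2 + 2 * (normN e * (A * u - B * v))) := by linarith
    exact le_of_mul_le_mul_left this hn'
  have hq0 : 0 ≤ q := normN_nonneg _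
  -- Adding 2δ‖e‖ₙ(Au + Bv) to 2‖e‖ₙ(Au - Bv) gives 2‖e‖ₙ((1+δ)Au - (1-δ)Bv). It is nonpositive in
  -- this case; otherwise v ≤ L_S u.
  by_cases hcone : (1 + δ) * A * u ≤ (1 - δ) * B * v
  · refine le_add_right (ENNReal.ofReal_le_ofReal ?_)
    have := mul_le_mul_of_nonneg_left hcone he.le
    nlinarith [sq_nonneg q]
  · push Not at hcone
    have hd1 : 0 < 1 - δ := by linarith
    have hu' : 0 < u := by
      refine hu0.lt_of_ne' fun h => ?_
      rw [h, mul_zero] at hcone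
      have : 0 ≤ (1 - δ) * B * v := by positivity
      linarith
    have hL : v ≤ A / B * ((1 + δ) / (1 - δ)) * u := by
      have : A / B * ((1 + δ) / (1 - δ)) * u = (1 + δ) * A * u / ((1 - δ) * B) := by
        field_simp
      rw [this, le_div_iff₀ (by positivity)]
      linarith
    have heig := eigenvalue_le X Ω S N hβ hu' hL
    have hΓ := ofReal_two_mul_sub_sq_le (k := normN e * ((1 + δ) * A)) (by positivity) hu' hq0 heig
    rw [mul_pow] at hΓ
    rw [effSparsitySq]
    refine le_trans ?_ (add_le_add le_rfl hΓ)
    refine le_trans (ENNReal.ofReal_le_ofReal ?_) ENNReal.ofReal_add_le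
    have : 0 ≤ normN e * ((1 - δ) * B * v) := by positivity
    linarith

/-- Prediction and estimation error bounds at an admissible set. -/
theorem IsEstimator.error_bounds {n p : ℕ} (hn : 0 < n)
    {X : Matrix (Fin n) (Fin p) ℝ} {β0 : Fin p → ℝ} {e : Fin n → ℝ} (he : 0 < normN e)
    {Ω : Seminorm ℝ (Fin p → ℝ)} (hΩ : IsNorm Ω) {S : Finset (Fin p)}
    {N : Seminorm ℝ ({j : Fin p // j ∉ S} → ℝ)} (hN : IsNorm N)
    (hS : WeaklyDecomposes Ω S N) {lam δ f C : ℝ} (hlam : 0 < lam) (hδ0 : 0 ≤ δ) (hδ1 : δ < 1)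
    (hf : f = fVal Ω lam β0 e) (hC : lamM X Ω S N e = C * lam) (hfC : 3 * (1 + f) * C < 1)
    {b : Fin p → ℝ} (hb : IsEstimator X (X *ᵥ β0 + e) Ω lam b)
    {β : Fin p → ℝ} (hβ : ∀ j, j ∉ S → β j = 0) :
    ENNReal.ofReal (normN (X *ᵥ (b - β0)) ^ 2)
        ≤ ENNReal.ofReal (normN (X *ᵥ (β - β0)) ^ 2)
          + ENNReal.ofReal (constC1 δ e f C * lam ^ 2) * gammaSq X Ω S N lam δ β0 e
    ∧ (0 < δ →
      ENNReal.ofReal (Ω (restr S b - β) + N (offPart S b))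
        ≤ ENNReal.ofReal (constC2 δ e f C)
          * (ENNReal.ofReal (normN (X *ᵥ (β - β0)) ^ 2 / lam)
            + ENNReal.ofReal (constC1 δ e f C * lam) * gammaSq X Ω S N lam δ β0 e)) := by
  have hf0 : 0 ≤ f := hf ▸ fVal_nonneg Ω hlam.le β0 e
  have hC0 : 0 ≤ C := by
    have := lamM_nonneg X Ω S N e
    rw [hC] at this
    exact nonneg_of_mul_nonneg_left this hlam
  set K := (1 - C * (1 + 2 * f)) / (f + 2) - C with hK
  -- K > 0 amounts to C(1 + 2f) + C(f + 2) < 1, which is exactly 3(1 + f)C < 1.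
  have hK0 : 0 < K := by
    rw [hK, sub_pos, lt_div_iff₀ (by linarith)]
    linarith
  have hK1 : K ≤ 1 := by
    have : (1 - C * (1 + 2 * f)) / (f + 2) ≤ 1 := by
      rw [div_le_one (by linarith)]
      nlinarith
    linarith
  have hB : lam * K ≤ lamStar X Ω lam β0 e - lamM X Ω S N e := by
    have := le_lamStar X hΩ hN hS hlam β0 e
    rw [← hf, hC, mul_div_cancel_right₀ _ hlam.ne'] at this
    rw [hC, hK]
    linarith
  have hA : lamTilde Ω lam β0 e + lamM X Ω S N e = lam * (f + C + 1) := by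
    rw [lamTilde, hC, ← hf]; ring
  have hmain := hb.sharp_oracle hn he hΩ hN hS hlam hδ0 hδ1
    (by linarith [mul_pos hlam hK0]) hβ
  have hcoef : normN e ^ 2 * ((1 + δ) * (lam * (f + C + 1))) ^ 2
      = constC1 δ e f C * lam ^ 2 := by rw [constC1]; ring
  rw [oracleBound, hA, hcoef] at hmain
  set u := Ω (restr S b - β) with hu
  set v := N (offPart S b) with hv
  have hu0 : 0 ≤ u := apply_nonneg _ _
  have hv0 : 0 ≤ v := apply_nonneg _ _
  -- λK is a common lower bound of both coefficients, as K ≤ 1 ≤ f + C + 1.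
  have hAB : lam * K * (u + v)
      ≤ lam * (f + C + 1) * u + (lamStar X Ω lam β0 e - lamM X Ω S N e) * v := by
    have h1 : lam * K ≤ lam * (f + C + 1) := mul_le_mul_of_nonneg_left (by linarith) hlam.le
    have h2 := mul_le_mul_of_nonneg_right h1 hu0
    have h3 := mul_le_mul_of_nonneg_right hB hv0
    linarith
  have hT0 : 0 ≤ lam * K * (u + v) := by positivity
  constructor
  · refine le_trans (ENNReal.ofReal_le_ofReal (le_add_of_nonneg_right ?_)) hmain
    exact mul_nonneg (by positivity) (hT0.trans hAB)
  · intro hδ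
    have hC2 : 0 < constC2 δ e f C := by
      rw [constC2, ← hK]; positivity
    -- C₂ is the inverse of 2δ‖e‖ₙK.
    have hT : u + v = constC2 δ e f C * (lam⁻¹ * (2 * δ * normN e * (lam * K * (u + v)))) := by
      rw [constC2, ← hK]
      field_simp
    have hle : ENNReal.ofReal (2 * δ * normN e * (lam * K * (u + v))) ≤ _ :=
      le_trans (ENNReal.ofReal_le_ofReal (le_add_of_nonneg_of_le (sq_nonneg _)
        (mul_le_mul_of_nonneg_left hAB (by positivity)))) hmain
    rw [hT, ENNReal.ofReal_mul hC2.le, ENNReal.ofReal_mul (inv_nonneg.2 hlam.le)]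
    refine mul_le_mul_right ((mul_le_mul_right hle _).trans (le_of_eq ?_)) _
    have hsq : lam⁻¹ * (constC1 δ e f C * lam ^ 2) = constC1 δ e f C * lam := by field_simp
    rw [mul_add, ← mul_assoc, ← ENNReal.ofReal_mul (inv_nonneg.2 hlam.le),
      ← ENNReal.ofReal_mul (inv_nonneg.2 hlam.le), hsq, inv_mul_eq_div]

/-! ### Positivity of the regularization level, and the noise vector -/

/-- Admissibility reads 0 ≤ 3(1 + f)λᵐ < λ once f ≥ 0 is known. For p = 0 nothing fixes the sign of
D, hence of λ, but then β⁰ = 0 and f = 0. -/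
lemma lam_pos_of_admissible {n p : ℕ} {X : Matrix (Fin n) (Fin p) ℝ}
    {Ω : Seminorm ℝ (Fin p → ℝ)}
    {ΩC : (S : Finset (Fin p)) → Seminorm ℝ ({j : Fin p // j ∉ S} → ℝ)}
    {lam : ℝ} {β0 : Fin p → ℝ} {e : Fin n → ℝ} {S : Finset (Fin p)}
    (hlam : 0 < p → 0 ≤ lam) (hS : Admissible X Ω ΩC lam β0 e S) : 0 < lam := by
  have hf : 0 ≤ fVal Ω lam β0 e := by
    rcases p.eq_zero_or_pos with rfl | hp
    · have h0 : β0 = 0 := Subsingleton.elim _ _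
      rw [fVal, h0, map_zero, mul_zero, zero_div]
    · exact fVal_nonneg Ω (hlam hp) β0 e
  refine lt_of_le_of_lt ?_ hS.2
  have := lamM_nonneg X Ω S (ΩC S) e
  positivity

lemma nonneg_of_norm_le_mul {p : ℕ} (hp : 0 < p) {Ω : Seminorm ℝ (Fin p → ℝ)} {D : ℝ}
    (hD : ∀ β : Fin p → ℝ, √(∑ j, β j ^ 2) ≤ D * Ω β) : 0 ≤ D := by
  by_contra hneg
  have h1 := hD 1
  have h2 : 0 < √(∑ j : Fin p, (1 : Fin p → ℝ) j ^ 2) := by simpa using hp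
  have h3 := mul_nonpos_of_nonpos_of_nonneg (not_le.1 hneg).le (apply_nonneg Ω 1)
  linarith

lemma ae_ne_zero_of_hasLaw_gaussianReal {𝓦 : Type*} [MeasurableSpace 𝓦] {μ : Measure 𝓦}
    {Z : 𝓦 → ℝ} {v : ℝ≥0} (hv : v ≠ 0) (hZ : HasLaw Z (gaussianReal 0 v) μ) :
    ∀ᵐ ω ∂μ, Z ω ≠ 0 := by
  have := nullSingletonClass_gaussianReal (μ := 0) hv
  have h : ∀ᵐ x ∂(gaussianReal 0 v), x ≠ 0 := by
    simp [ae_iff, measure_singleton]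
  rw [← hZ.map_eq] at h
  exact ae_of_ae_map hZ.aemeasurable h

end SqrtReg

theorem corollary2
    {n p : ℕ} (hn : 0 < n)
    -- design, true parameter, norm, and the norms `Ω^{Sᶜ}` of the allowed sets `S`
    (X : Matrix (Fin n) (Fin p) ℝ) (β0 : Fin p → ℝ)
    (Ω : Seminorm ℝ (Fin p → ℝ)) (hΩ : SqrtReg.IsNorm Ω)
    (ΩC : (S : Finset (Fin p)) → Seminorm ℝ ({j : Fin p // j ∉ S} → ℝ))
    (hΩC : ∀ S, SqrtReg.Allowed Ω S →
      SqrtReg.IsNorm (ΩC S) ∧ SqrtReg.WeaklyDecomposes Ω S (ΩC S))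
    -- i.i.d. Gaussian errors with variance `σ²`
    {𝓦 : Type*} [MeasurableSpace 𝓦] (μ : Measure 𝓦) [IsProbabilityMeasure μ]
    (σ : ℝ≥0) (hσ : 0 < σ) (ε : Fin n → 𝓦 → ℝ)
    (hε : ∀ i, HasLaw (ε i) (gaussianReal 0 (σ ^ 2)) μ) (hind : iIndepFun ε μ)
    -- the regularization level
    (δ : ℝ) (hδ0 : 0 ≤ δ) (hδ1 : δ < 1)
    (α : ℝ) (hα0 : 0 < α) (hα1 : α < 1)
    (t : ℝ) (ht : t = √(Real.log (4 / α)))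
    (Δ : ℝ) (hΔ0 : 0 < Δ) (hΔ : Δ ^ 2 = 1 - t * √(2 / n) ∨ Δ ^ 2 = 1 - t * (2 / √n))
    (D : ℝ) (hD : ∀ β : Fin p → ℝ, √(∑ j, β j ^ 2) ≤ D * Ω β)
    (W : Finset (Fin p)) (hW : SqrtReg.Allowed Ω W)
    (lam : ℝ)
    (hlam : lam = t / Δ * D * √(2 / n)
      + ∫ ω, SqrtReg.maxDual X Ω W (ΩC W) (fun i => ε i ω) / (n * σ) ∂μ) :
    ∃ E : Set 𝓦, MeasurableSet E ∧ ENNReal.ofReal (1 - α) ≤ μ E ∧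
      ∀ ω ∈ E, ∀ (e : Fin n → ℝ), e = (fun i => ε i ω) →
      ∀ (b : Fin p → ℝ), SqrtReg.IsEstimator X (X *ᵥ β0 + e) Ω lam b →
      ∀ (S : Finset (Fin p)) (β : Fin p → ℝ), SqrtReg.IsOracle X Ω ΩC lam δ β0 e S β →
      ∀ (f C : ℝ), f = SqrtReg.fVal Ω lam β0 e → SqrtReg.lamM X Ω S (ΩC S) e = C * lam →
        ENNReal.ofReal (SqrtReg.normN (X *ᵥ (b - β0)) ^ 2)
            ≤ ENNReal.ofReal (SqrtReg.normN (X *ᵥ (β - β0)) ^ 2)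
              + ENNReal.ofReal (SqrtReg.constC1 δ e f C * lam ^ 2)
                * SqrtReg.gammaSq X Ω S (ΩC S) lam δ β0 e
        ∧ (0 < δ →
          ENNReal.ofReal (Ω (SqrtReg.restr S b - β) + ΩC S (SqrtReg.offPart S b))
            ≤ ENNReal.ofReal (SqrtReg.constC2 δ e f C)
              * (ENNReal.ofReal (SqrtReg.normN (X *ᵥ (β - β0)) ^ 2 / lam)
                + ENNReal.ofReal (SqrtReg.constC1 δ e f C * lam)
                  * SqrtReg.gammaSq X Ω S (ΩC S) lam δ β0 e)) := by
  have hlam0 : 0 < p → 0 ≤ lam := by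
    intro hp
    have hD0 := SqrtReg.nonneg_of_norm_le_mul hp hD
    have ht0 : 0 ≤ t := ht ▸ Real.sqrt_nonneg _
    have hint : 0 ≤ ∫ ω, SqrtReg.maxDual X Ω W (ΩC W) (fun i => ε i ω) / (n * σ) ∂μ :=
      integral_nonneg fun ω => div_nonneg (SqrtReg.maxDual_nonneg _ _ _ _ _) (by positivity)
    rw [hlam]
    positivity
  -- The bounds hold wherever the noise does not vanish, hence almost surely.
  have hnull : μ {ω | ε ⟨0, hn⟩ ω = 0} = 0 := by
    simpa [ae_iff] using
      SqrtReg.ae_ne_zero_of_hasLaw_gaussianReal (pow_ne_zero 2 hσ.ne') (hε ⟨0, hn⟩)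
  -- The errors are only a.e. measurable, so the null set is replaced by a measurable hull.
  have hmeas := measurableSet_toMeasurable μ {ω | ε ⟨0, hn⟩ ω = 0}
  refine ⟨(toMeasurable μ {ω | ε ⟨0, hn⟩ ω = 0})ᶜ, hmeas.compl, ?_, ?_⟩
  · rw [(prob_compl_eq_one_iff hmeas).2 (by rw [measure_toMeasurable, hnull])]
    exact ENNReal.ofReal_le_one.2 (by linarith)
  · intro ω hω e he b hb S β hor f C hf hC
    obtain ⟨hadm, hβ, -⟩ := hor
    have hepos : 0 < SqrtReg.normN e := by
      refine SqrtReg.normN_pos hn fun h0 => hω (subset_toMeasurable _ _ ?_)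
      simpa [he] using congrFun h0 ⟨0, hn⟩
    have hlampos := SqrtReg.lam_pos_of_admissible hlam0 hadm
    obtain ⟨hN, hdec⟩ := hΩC S hadm.1
    refine hb.error_bounds hn hepos hΩ hN hdec hlampos hδ0 hδ1 hf hC ?_ hβ
    have h := hadm.2
    rw [← hf, hC, ← mul_assoc] at h
    exact lt_of_mul_lt_mul_right (by linarith) hlampos.le
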